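/- Let $d\ge 0$ and let $\mathbb C[[x]]=\mathbb C[[x_1,\dots,x_d]]$. A formal self-map of $(\mathbb C^d,0)$ is a $d$-tuple $F=(F_1,\dots,F_d)$ of formal series without free terms, and $F^*f=f\circ F$ for $f\in\mathbb C[[x]]$; let $\mathrm{Diff}[[\mathbb C^d,0]]$ be the group of invertible formal self-maps under composition. A formal vector field $v$ is a $d$-tuple of formal series without free terms; its formal flow is the one-parametric subgroup $\{e^{tv}:t\in\mathbb C\}\subset\mathrm{Diff}[[\mathbb C^d,0]]$ (that is, $e^{(s+t)v}=e^{sv}\circ e^{tv}$) with $\frac{d}{dt}e^{tv}\big|_{t=0}=v$, the derivative being taken coefficient by coefficient. A subgroup $G\subset\mathrm{Diff}[[\mathbb C^d,0]]$ is called finitely generated if there are finitely many $F_1,\dots,F_p\in\mathrm{Diff}[[\mathbb C^d,0]]$ and finitely many formal vector fields $v_1,\dots,v_q$ ($p,q\ge 0$) such that $G$ is generated as a group by $F_1,\dots,F_p$ and all the maps $e^{tv_k}$, $t\in\mathbb C$, $k=1,\dots,q$. A formal subvariety $X$ is given by a radical ideal $I_X\subset\mathbb C[[x]]$; the preimage $g^{-1}(X)$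 of $X$ by $g\in\mathrm{Diff}[[\mathbb C^d,0]]$ is given by the ideal $g^*I_X$; and the intersection multiplicity of two formal subvarieties is $\mu(X,Y)=\dim_{\mathbb C}\mathbb C[[x]]/(I_X+I_Y)\in\mathbb N\cup\{+\infty\}$. **Theorem.** Let $G\subset\mathrm{Diff}[[\mathbb C^d,0]]$ be a commutative finitely generated subgroup. Then for any two formal subvarieties $X,Y$ there exists a finite constant $m\in\mathbb N$, depending on $G$, $X$ and $Y$, such that for all $g\in G$ $$\mu(g^{-1}(X),Y)<+\infty\implies \mu(g^{-1}(X),Y)\le m.$$ -/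

import Mathlib

noncomputable section

/-- A formal self-map of `(ℂ^d, 0)`: a `d`-tuple of formal series in `d` variables
without free terms. -/
@[ext]
structure FormalSelfMap (d : ℕ) where
  /-- the components of the map -/
  comp : Fin d → MvPowerSeries (Fin d) ℂ
  constantCoeff_comp : ∀ i, MvPowerSeries.constantCoeff (comp i) = 0

namespace FormalSelfMap

variable {d : ℕ}

theorem hasSubst (F : FormalSelfMap d) : MvPowerSeries.HasSubst F.comp :=
  MvPowerSeries.hasSubst_of_constantCoeff_zero F.constantCoeff_comp

/-- The composition operator `F^* : f ↦ f ∘ F` on `ℂ[[x₁, …, x_d]]`. -/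
def pullback (F : FormalSelfMap d) :
    MvPowerSeries (Fin d) ℂ →ₐ[ℂ] MvPowerSeries (Fin d) ℂ :=
  MvPowerSeries.substAlgHom F.hasSubst

theorem pullback_apply (F : FormalSelfMap d) (f : MvPowerSeries (Fin d) ℂ) :
    F.pullback f = MvPowerSeries.subst F.comp f :=
  MvPowerSeries.substAlgHom_apply F.hasSubst f

/-- The identity map. -/
instance : One (FormalSelfMap d) where
  one := ⟨fun i => MvPowerSeries.X i, fun i => MvPowerSeries.constantCoeff_X i⟩

/-- The product `F * G` is the composition `F ∘ G`, with components `Fᵢ(G₁(x), …, G_d(x))`. -/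
instance : Mul (FormalSelfMap d) where
  mul F G := ⟨fun i => G.pullback (F.comp i), fun i => by
    rw [pullback_apply]
    exact MvPowerSeries.constantCoeff_subst_eq_zero G.hasSubst G.constantCoeff_comp
      (F.constantCoeff_comp i)⟩

theorem one_comp (i : Fin d) : (1 : FormalSelfMap d).comp i = MvPowerSeries.X i := rfl

theorem mul_comp (F G : FormalSelfMap d) (i : Fin d) :
    (F * G).comp i = G.pullback (F.comp i) := rfl

theorem pullback_one (f : MvPowerSeries (Fin d) ℂ) :
    (1 : FormalSelfMap d).pullback f = f := by
  rw [pullback_apply]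
  exact congrFun MvPowerSeries.subst_self f

theorem pullback_mul (F G : FormalSelfMap d) (f : MvPowerSeries (Fin d) ℂ) :
    (F * G).pullback f = G.pullback (F.pullback f) := by
  simp only [pullback_apply]
  rw [MvPowerSeries.subst_comp_subst_apply F.hasSubst G.hasSubst]
  congr 1
  funext i
  rw [mul_comp, pullback_apply]

/-- Formal self-maps form a monoid under composition. -/
instance : Monoid (FormalSelfMap d) where
  mul_assoc F G H := by
    ext1
    funext i
    simp only [mul_comp, pullback_mul]
  one_mul F := by
    ext1
    funext i
    rw [mul_comp, one_comp, pullback_apply, MvPowerSeries.subst_X F.hasSubst]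
  mul_one F := by
    ext1
    funext i
    rw [mul_comp, pullback_one]

end FormalSelfMap

/-- The group of invertible formal self-maps of `(ℂ^d, 0)` under composition. -/
abbrev FormalDiff (d : ℕ) : Type := (FormalSelfMap d)ˣ

/-- The composition operator `g^* : f ↦ f ∘ g` of an invertible formal self-map, as an
automorphism of the algebra `ℂ[[x₁, …, x_d]]`. -/
def FormalDiff.pullbackEquiv {d : ℕ} (g : FormalDiff d) :
    MvPowerSeries (Fin d) ℂ ≃ₐ[ℂ] MvPowerSeries (Fin d) ℂ :=
  AlgEquiv.ofAlgHom (FormalSelfMap.pullback g.val) (FormalSelfMap.pullback g.inv)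
    (by
      apply AlgHom.ext
      intro f
      rw [AlgHom.comp_apply, ← FormalSelfMap.pullback_mul, g.inv_val,
        FormalSelfMap.pullback_one, AlgHom.id_apply])
    (by
      apply AlgHom.ext
      intro f
      rw [AlgHom.comp_apply, ← FormalSelfMap.pullback_mul, g.val_inv,
        FormalSelfMap.pullback_one, AlgHom.id_apply])

/-- A formal vector field on `(ℂ^d, 0)` with a singular point at the origin: a `d`-tuple of
formal series without free terms. -/
structure FormalVectorField (d : ℕ) where
  /-- the components of the field -/
  comp : Fin d → MvPowerSeries (Fin d) ℂ
  constantCoeff_comp : ∀ i, MvPowerSeries.constantCoeff (comp i) = 0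

/-- `φ` is the formal flow `t ↦ e^{tv}` of the formal vector field `v`: a one-parametric subgroup
`{φ t : t ∈ ℂ}` of invertible formal self-maps with `d/dt φ t = v` at `t = 0`, where the derivative
is taken coefficient by coefficient. -/
def IsFormalFlow {d : ℕ} (v : FormalVectorField d) (φ : Multiplicative ℂ →* FormalDiff d) : Prop :=
  ∀ (i : Fin d) (n : Fin d →₀ ℕ),
    HasDerivAt (fun t : ℂ => MvPowerSeries.coeff n ((φ (Multiplicative.ofAdd t)).val.comp i))
      (MvPowerSeries.coeff n (v.comp i)) 0

/-- The subgroup `G` is generated by finitely many invertible formal self-maps `F₁, …, F_p` and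
by the flows `e^{tv₁}, …, e^{tv_q}`, `t ∈ ℂ`, of finitely many formal vector fields. -/
def IsFinitelyGeneratedByMapsAndFlows {d : ℕ} (G : Subgroup (FormalDiff d)) : Prop :=
  ∃ (p q : ℕ) (F : Fin p → FormalDiff d) (v : Fin q → FormalVectorField d)
    (φ : Fin q → Multiplicative ℂ →* FormalDiff d),
    (∀ k, IsFormalFlow (v k) (φ k)) ∧
    G = Subgroup.closure (Set.range F ∪ ⋃ k, Set.range (φ k))

/-- A formal subvariety of `(ℂ^d, 0)`, identified with a radical ideal of `ℂ[[x₁, …, x_d]]`. -/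
structure FormalSubvariety (d : ℕ) where
  /-- the ideal of the subvariety -/
  ideal : Ideal (MvPowerSeries (Fin d) ℂ)
  isRadical : ideal.IsRadical

/-- The preimage `g⁻¹(X)`, given by the ideal `g^* I_X`. -/
def FormalSubvariety.preimage {d : ℕ} (g : FormalDiff d) (X : FormalSubvariety d) :
    FormalSubvariety d where
  ideal := X.ideal.map g.pullbackEquiv
  isRadical := by
    intro f hf
    obtain ⟨n, hn⟩ := hf
    obtain ⟨a, ha, hab⟩ := (Ideal.mem_map_of_equiv g.pullbackEquiv (f ^ n)).1 hn
    refine (Ideal.mem_map_of_equiv g.pullbackEquiv f).2 ⟨g.pullbackEquiv.symm f, ?_, by simp⟩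
    refine X.isRadical ⟨n, ?_⟩
    rw [← map_pow, ← hab, AlgEquiv.symm_apply_apply]
    exact ha

/-- The intersection multiplicity `μ(X, Y) = codim_ℂ ⟨I_X, I_Y⟩ ∈ ℕ ∪ {∞}`. -/
def intersectionMultiplicity {d : ℕ} (X Y : FormalSubvariety d) : ℕ∞ :=
  Cardinal.toENat (Module.rank ℂ (MvPowerSeries (Fin d) ℂ ⧸ (X.ideal ⊔ Y.ideal)))

end

/-!
A commutative group generated by `F₁, …, F_p` and the flows of `v₁, …, v_q` consists of the maps
`F₁^{k₁} ∘ ⋯ ∘ F_p^{k_p} ∘ e^{t₁ v₁} ∘ ⋯ ∘ e^{t_q v_q}`, so it is parametrized by `ℤ^p × ℂ^q`.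

The coefficients of these maps are quasi-polynomials, polynomials in the parameters and in
*finitely many* exponentials. Indeed, if `T` denotes `F^*` or the derivation `v`, a coefficient
`a(t)` of the pullback of `f` satisfies a first-order difference or differential equation whose
right-hand side is the same coefficient for `(T - s) f`. A quasi-polynomial right-hand side forces
a quasi-polynomial solution, so one may work along the generalized eigenspaces of `T`. Those on
`𝔪²` need not be considered: a coefficient of a product of two elements of `𝔪` is a polynomial in
coefficients of lower degree of the factors. Hence only the eigenvalues of `T` on the
finite-dimensional space `ℂ[[x]]/𝔪²` contribute exponentials.

So the coefficients lie in a finitely generated, hence Noetherian, algebra `R` of functions of the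
parameter. By Nakayama's lemma the condition `μ ≤ k` can be tested modulo `𝔪^(k+1)`, where it says
that some minor of given size, with entries in `R`, does not vanish. The sets `{μ ≤ k}` thus form an
increasing chain of open sets in a Noetherian Zariski topology, and such a chain stabilizes.
-/

section LinearAlgebra

open Module

variable {K V : Type*} [Field K] [AddCommGroup V] [Module K V]

theorem eq_top_of_forall_hasEigenvalue [IsAlgClosed K] [FiniteDimensional K V]
    (T : End K V) (C : Submodule K V)
    (hC : ∀ s, T.HasEigenvalue s → ∀ v, T v - s • v ∈ C → v ∈ C) : C = ⊤ := by
  have mem_of_pow : ∀ s, T.HasEigenvalue s → ∀ (k : ℕ) (v : V),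
      ((T - s • (1 : End K V)) ^ k) v = 0 → v ∈ C := by
    intro s hs k
    induction k with
    | zero => intro v hv; simp_all
    | succ k ih => exact fun v hv => hC s hs v (ih _ (by simpa [pow_succ] using hv))
  rw [eq_top_iff, ← End.iSup_maxGenEigenspace_eq_top T]
  refine iSup_le fun s => ?_
  rcases eq_or_ne (T.maxGenEigenspace s) ⊥ with hbot | hne
  · exact hbot ▸ bot_le
  · intro v hv
    obtain ⟨k, hk⟩ := (End.mem_maxGenEigenspace T s v).1 hv
    exact mem_of_pow s (End.HasUnifEigenvalue.lt zero_lt_one hne) k v hk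

theorem eq_top_of_le_of_forall_hasEigenvalue_mapQ [IsAlgClosed K] (T : End K V)
    {N C : Submodule K V} [FiniteDimensional K (V ⧸ N)] (hT : N ≤ N.comap T) (hNC : N ≤ C)
    (hC : ∀ s, End.HasEigenvalue (N.mapQ N T hT) s → ∀ v, T v - s • v ∈ C → v ∈ C) : C = ⊤ := by
  have comap_map : (C.map N.mkQ).comap N.mkQ = C := by
    rw [Submodule.comap_map_mkQ, sup_eq_right.2 hNC]
  have map_eq_top : C.map N.mkQ = ⊤ := by
    refine eq_top_of_forall_hasEigenvalue (N.mapQ N T hT) _ fun s hs v hv => ?_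
    obtain ⟨v, rfl⟩ := N.mkQ_surjective v
    rw [← Submodule.mem_comap, comap_map]
    refine hC s hs v ?_
    rwa [← comap_map, Submodule.mem_comap, map_sub, map_smul]
  rw [← comap_map, map_eq_top, Submodule.comap_top]

theorem exists_le_le_succ_of_antitone [FiniteDimensional K V] {k : ℕ} (hk : finrank K V ≤ k)
    {N : ℕ → Submodule K V} (hN : Antitone N) : ∃ j ≤ k, N j ≤ N (j + 1) := by
  by_contra! h
  have finrank_add_le : ∀ j ≤ k + 1, finrank K (N j) + j ≤ finrank K V := by
    intro j hj
    induction j with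
    | zero => simpa using (N 0).finrank_le
    | succ j ih =>
      have : finrank K (N (j + 1)) < finrank K (N j) := Submodule.finrank_lt_finrank_of_lt
        (lt_of_le_not_ge (hN j.le_succ) (h j (by omega)))
      have := ih (by omega)
      omega
  have := finrank_add_le (k + 1) le_rfl
  omega

theorem finrank_quotient_le_iff_exists_linearIndependent [FiniteDimensional K V]
    (N : Submodule K V) (k : ℕ) :
    finrank K (V ⧸ N) ≤ k ↔
      ∃ s : Fin (finrank K V - k) → V, (∀ i, s i ∈ N) ∧ LinearIndependent K s := by
  have finrank_add := N.finrank_quotient_add_finrank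
  constructor
  · intro h
    obtain ⟨s, hs⟩ := exists_linearIndependent_of_le_finrank
      (show finrank K V - k ≤ finrank K N by omega)
    exact ⟨fun i => s i, fun i => (s i).2, hs.map' N.subtype N.ker_subtype⟩
  · rintro ⟨s, hsN, hs⟩
    have hs' : LinearIndependent K fun i => (⟨s i, hsN i⟩ : N) :=
      LinearIndependent.of_comp N.subtype hs
    have := hs'.fintype_card_le_finrank
    rw [Fintype.card_fin] at this
    omega

theorem mem_of_forall_smul_succ_add_mem (D : Submodule K V) (c : ℕ → V) (α : K) (β : ℕ → K)
    (hβ : ∀ j, β j ≠ 0) (h0 : α • c 0 ∈ D)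
    (hsucc : ∀ j, ∃ w ∈ Submodule.span K (c '' Set.Iio j),
      α • c (j + 1) + (β j • c j + w) ∈ D) (j : ℕ) : c j ∈ D := by
  induction j using Nat.strong_induction_on with
  | _ j ih =>
    have span_le : ∀ i ≤ j, Submodule.span K (c '' Set.Iio i) ≤ D := fun i hi =>
      Submodule.span_le.2 (Set.image_subset_iff.2 fun l hl => ih l (lt_of_lt_of_le hl hi))
    by_cases hα : α = 0
    · obtain ⟨w, hw, h⟩ := hsucc j
      rw [hα, zero_smul, zero_add] at h
      exact (D.smul_mem_iff (hβ j)).1 ((D.add_mem_iff_left (span_le j le_rfl hw)).1 h)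
    · refine (D.smul_mem_iff hα).1 ?_
      cases j with
      | zero => exact h0
      | succ j =>
        obtain ⟨w, hw, h⟩ := hsucc j
        exact (D.add_mem_iff_left (D.add_mem (D.smul_mem _ (ih j j.lt_succ_self))
          (span_le j j.le_succ hw))).1 h

end LinearAlgebra

section ZariskiOpen

variable {K Λ : Type*} [Field K]

/-- The sets `U` that are open for the topology on `Λ` whose closed sets are the common zero loci
of elements of the algebra `R` of functions on `Λ`. -/
def IsZariskiOpen (R : Subalgebra K (Λ → K)) (U : Set Λ) : Prop :=
  ∀ a ∈ U, ∃ r ∈ R, r a ≠ 0 ∧ ∀ b, r b ≠ 0 → b ∈ U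

/-- The ideal of the elements of `R` vanishing on the set `S`. -/
def vanishingIdealOn (R : Subalgebra K (Λ → K)) (S : Set Λ) : Ideal R :=
  ⨅ a ∈ S, RingHom.ker ((Pi.evalRingHom (fun _ : Λ => K) a).comp R.val.toRingHom)

theorem mem_vanishingIdealOn {R : Subalgebra K (Λ → K)} {S : Set Λ} {r : R} :
    r ∈ vanishingIdealOn R S ↔ ∀ a ∈ S, (r : Λ → K) a = 0 := by
  simp [vanishingIdealOn, RingHom.mem_ker]

theorem IsZariskiOpen.subset_of_vanishingIdealOn_compl_le {R : Subalgebra K (Λ → K)}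
    {U V : Set Λ} (hV : IsZariskiOpen R V)
    (h : vanishingIdealOn R Vᶜ ≤ vanishingIdealOn R Uᶜ) : V ⊆ U := by
  intro a ha
  obtain ⟨r, hr, hra, hrV⟩ := hV a ha
  by_contra haU
  refine hra (mem_vanishingIdealOn.1 (h (mem_vanishingIdealOn.2 fun b hb => ?_) :
    (⟨r, hr⟩ : R) ∈ _) a haU)
  exact not_not.1 fun hrb => hb (hrV b hrb)

theorem IsZariskiOpen.exists_forall_subset_of_monotone {R : Subalgebra K (Λ → K)}
    [IsNoetherianRing R] {U : ℕ → Set Λ} (hU : Monotone U) (hopen : ∀ k, IsZariskiOpen R (U k)) :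
    ∃ m, ∀ k, U k ⊆ U m := by
  have mono : Monotone fun k => vanishingIdealOn R (U k)ᶜ := fun k l hkl r hr =>
    mem_vanishingIdealOn.2 fun a ha => mem_vanishingIdealOn.1 hr a fun hak => ha (hU hkl hak)
  obtain ⟨m, hm⟩ := monotone_stabilizes_iff_noetherian.2 ‹IsNoetherianRing R›
    ⟨fun k => vanishingIdealOn R (U k)ᶜ, mono⟩
  refine ⟨m, fun k => ?_⟩
  rcases le_total k m with hkm | hmk
  · exact hU hkm
  · exact (hopen k).subset_of_vanishingIdealOn_compl_le (hm k hmk).ge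

theorem isZariskiOpen_linearIndependent {R : Subalgebra K (Λ → K)} {V ι : Type*}
    [AddCommGroup V] [Module K V] [Finite ι] (s : Λ → ι → V)
    (hs : ∀ (ℓ : Module.Dual K V) (i : ι), (fun a => ℓ (s a i)) ∈ R) :
    IsZariskiOpen R {a | LinearIndependent K (s a)} := by
  classical
  have := Fintype.ofFinite ι
  intro a ha
  obtain ⟨L, hL⟩ := LinearMap.exists_leftInverse_of_injective (Fintype.linearCombination K (s a))
    (LinearMap.ker_eq_bot.2 (linearIndependent_iff_injective_fintypeLinearCombination.1 ha))
  have L_apply : ∀ i, L (s a i) = Pi.single i 1 := fun i => by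
    simpa using LinearMap.congr_fun hL (Pi.single i 1)
  let M : Λ → Matrix ι ι K := fun b => Matrix.of fun i => L (s b i)
  have M_mem : ∀ i j, (fun b => M b i j) ∈ R := fun i j => hs (LinearMap.proj j ∘ₗ L) i
  have M_self : M a = 1 := by
    ext i j
    simp [M, L_apply, Matrix.one_apply, Pi.single_apply, eq_comm]
  refine ⟨fun b => (M b).det, ?_, by simp [M_self], fun b hb => ?_⟩
  · have det_eq : (fun b => (M b).det) =
        ∑ τ : Equiv.Perm ι, Equiv.Perm.sign τ • ∏ i, fun b => M b (τ i) i := by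
      ext b
      simp [Matrix.det_apply]
    rw [det_eq]
    exact R.sum_mem fun τ _ => R.toSubmodule.smul_of_tower_mem _
      (R.prod_mem fun i _ => M_mem (τ i) i)
  · exact LinearIndependent.of_comp L
      (Matrix.linearIndependent_rows_of_isUnit ((Matrix.isUnit_iff_isUnit_det _).2 hb.isUnit))

end ZariskiOpen

section LocalAlgebra

open IsLocalRing Module

variable {K A : Type*} [Field K] [CommRing A] [IsLocalRing A]

theorem maximalIdeal_pow_le_of_le_sup [IsNoetherianRing A] {I : Ideal A} {j : ℕ}
    (h : maximalIdeal A ^ j ≤ I ⊔ maximalIdeal A ^ (j + 1)) : maximalIdeal A ^ j ≤ I := by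
  refine Submodule.le_of_le_smul_of_le_jacobson_bot (I := maximalIdeal A)
    (IsNoetherian.noetherian _) (maximalIdeal_le_jacobson ⊥) ?_
  rwa [smul_eq_mul, ← pow_succ']

variable [Algebra K A] [IsNoetherianRing A]

theorem maximalIdeal_pow_le_of_rank_quotient_sup_le {I : Ideal A} {k : ℕ}
    (h : Module.rank K (A ⧸ (I ⊔ maximalIdeal A ^ (k + 1))) ≤ k) :
    maximalIdeal A ^ (k + 1) ≤ I := by
  set Q := I ⊔ maximalIdeal A ^ (k + 1)
  have : FiniteDimensional K (A ⧸ Q) :=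
    rank_lt_aleph0_iff.1 (h.trans_lt Cardinal.natCast_lt_aleph0)
  obtain ⟨j, hjk, hj⟩ := exists_le_le_succ_of_antitone (K := K) (V := A ⧸ Q)
    (finrank_le_of_rank_le h)
    (N := fun j => ((maximalIdeal A ^ j).map (Ideal.Quotient.mk Q)).restrictScalars K)
    fun i j hij => Ideal.map_mono (Ideal.pow_le_pow_right hij)
  have pow_le_sup : maximalIdeal A ^ j ≤ I ⊔ maximalIdeal A ^ (j + 1) := by
    have le_sup := Ideal.map_le_iff_le_comap.1 hj
    rw [Ideal.comap_map_quotientMk] at le_sup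
    exact le_sup.trans (sup_le (sup_le_sup_left (Ideal.pow_le_pow_right (by omega)) _) le_sup_right)
  exact (Ideal.pow_le_pow_right (hjk.trans k.le_succ)).trans
    (maximalIdeal_pow_le_of_le_sup pow_le_sup)

theorem rank_quotient_le_iff_rank_quotient_sup_le (I : Ideal A) (k : ℕ) :
    Module.rank K (A ⧸ I) ≤ k ↔ Module.rank K (A ⧸ (I ⊔ maximalIdeal A ^ (k + 1))) ≤ k := by
  refine ⟨fun h => le_trans ?_ h, fun h => ?_⟩
  · exact LinearMap.rank_le_of_surjective (Ideal.Quotient.factorₐ K le_sup_left).toLinearMap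
      (Ideal.Quotient.factor_surjective le_sup_left)
  · rwa [sup_eq_left.2 (maximalIdeal_pow_le_of_rank_quotient_sup_le h)] at h

theorem rank_quotient_le_iff_exists_linearIndependent (I : Ideal A) (k : ℕ)
    [FiniteDimensional K (A ⧸ maximalIdeal A ^ (k + 1))] :
    Module.rank K (A ⧸ I) ≤ k ↔
      ∃ s : Fin (finrank K (A ⧸ maximalIdeal A ^ (k + 1)) - k) → A, (∀ i, s i ∈ I) ∧
        LinearIndependent K fun i => Ideal.Quotient.mk (maximalIdeal A ^ (k + 1)) (s i) := by
  rw [rank_quotient_le_iff_rank_quotient_sup_le]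
  set Q := maximalIdeal A ^ (k + 1)
  have e : ((A ⧸ Q) ⧸ (I.map (Ideal.Quotient.mkₐ K Q))) ≃ₐ[K] A ⧸ (I ⊔ Q) :=
    (DoubleQuot.quotQuotEquivQuotSupₐ K Q I).trans
      (Ideal.quotientEquivAlgOfEq K (sup_comm Q I))
  rw [← e.toLinearEquiv.rank_eq, ← (Submodule.Quotient.restrictScalarsEquiv K _).rank_eq,
    ← finrank_eq_rank, Nat.cast_le, finrank_quotient_le_iff_exists_linearIndependent]
  constructor
  · rintro ⟨t, ht, hli⟩
    choose s hs hst using fun i =>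
      (Ideal.mem_map_iff_of_surjective _ Ideal.Quotient.mk_surjective).1 (ht i)
    refine ⟨s, hs, ?_⟩
    rwa [← funext hst] at hli
  · rintro ⟨s, hs, hli⟩
    exact ⟨_, fun i => Ideal.mem_map_of_mem _ (hs i), hli⟩

end LocalAlgebra

section PowerSeries

open MvPowerSeries IsLocalRing

variable {σ K : Type*} [Field K]

theorem mem_maximalIdeal_iff_constantCoeff_eq_zero {f : MvPowerSeries σ K} :
    f ∈ maximalIdeal (MvPowerSeries σ K) ↔ constantCoeff f = 0 := by
  rw [mem_maximalIdeal, mem_nonunits_iff, MvPowerSeries.isUnit_iff_constantCoeff,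
    isUnit_iff_ne_zero, not_not]

theorem monomial_mem_maximalIdeal_pow_degree (n : σ →₀ ℕ) :
    monomial n (1 : K) ∈ maximalIdeal (MvPowerSeries σ K) ^ n.degree := by
  have map_le : (MvPolynomial.idealOfVars σ K).map MvPolynomial.coeToMvPowerSeries.ringHom ≤
      maximalIdeal (MvPowerSeries σ K) := by
    rw [MvPolynomial.idealOfVars, Ideal.map_span, Ideal.span_le]
    rintro _ ⟨_, ⟨i, rfl⟩, rfl⟩
    exact mem_maximalIdeal_iff_constantCoeff_eq_zero.2 (by simp)
  have mem_map := Ideal.mem_map_of_mem MvPolynomial.coeToMvPowerSeries.ringHom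
    ((MvPolynomial.monomial_mem_pow_idealOfVars_iff n.degree n (one_ne_zero (α := K))).2 le_rfl)
  rw [Ideal.map_pow] at mem_map
  simpa using Ideal.pow_right_mono map_le _ mem_map

theorem le_order_of_mem_maximalIdeal_pow {j : ℕ} {f : MvPowerSeries σ K}
    (hf : f ∈ maximalIdeal (MvPowerSeries σ K) ^ j) : j ≤ f.order := by
  induction j generalizing f with
  | zero => simp
  | succ j ih =>
    rw [pow_succ] at hf
    refine Submodule.mul_induction_on hf (fun u hu v hv => ?_) fun u v hu hv => ?_
    · rw [Nat.cast_add]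
      refine le_trans (add_le_add (ih hu) ?_) le_order_mul
      exact_mod_cast one_le_order_iff_constCoeff_eq_zero.2
        (mem_maximalIdeal_iff_constantCoeff_eq_zero.1 hv)
    · exact (le_min hu hv).trans min_order_le_add

theorem map_maximalIdeal_le_of_algHom (ψ : MvPowerSeries σ K →ₐ[K] MvPowerSeries σ K) :
    (maximalIdeal (MvPowerSeries σ K)).map ψ ≤ maximalIdeal (MvPowerSeries σ K) := by
  rw [Ideal.map_le_iff_le_comap]
  intro f hf
  rw [mem_maximalIdeal_iff_constantCoeff_eq_zero] at hf
  rw [Ideal.mem_comap, mem_maximalIdeal_iff_constantCoeff_eq_zero]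
  by_contra hne
  set c := constantCoeff (ψ f)
  have isUnit_sub : IsUnit (f - algebraMap K _ c) := by
    rw [MvPowerSeries.isUnit_iff_constantCoeff, isUnit_iff_ne_zero]
    simpa [hf, MvPowerSeries.algebraMap_apply] using hne
  have := isUnit_sub.map ψ
  rw [MvPowerSeries.isUnit_iff_constantCoeff, isUnit_iff_ne_zero] at this
  exact this (by rw [map_sub, ψ.commutes]; simp [c, MvPowerSeries.algebraMap_apply])

variable [Finite σ]

theorem mem_maximalIdeal_pow_iff_coeff_eq_zero {j : ℕ} {f : MvPowerSeries σ K} :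
    f ∈ maximalIdeal (MvPowerSeries σ K) ^ j ↔ ∀ n : σ →₀ ℕ, n.degree < j → coeff n f = 0 := by
  classical
  refine ⟨fun hf n hn => coeff_of_lt_order
    (lt_of_lt_of_le (by exact_mod_cast hn) (le_order_of_mem_maximalIdeal_pow hf)), fun hf => ?_⟩
  -- Each monomial `n` of degree at least `j` is charged to one divisor `c n` of degree `j`.
  choose c hc using fun n : σ →₀ ℕ =>
    (show ∃ m : σ →₀ ℕ, j ≤ n.degree → m ≤ n ∧ m.degree = j by
      by_cases hn : j ≤ n.degree
      · exact (n.exists_le_degree_eq j hn).imp fun m hm _ => hm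
      · exact ⟨0, fun h => absurd h hn⟩)
  let q : (σ →₀ ℕ) → MvPowerSeries σ K := fun m l => if c (m + l) = m then coeff (m + l) f else 0
  have f_eq_sum : f = ∑ m ∈ (Finsupp.finite_of_degree_eq j).toFinset, monomial m 1 * q m := by
    ext n
    have coeff_term : ∀ m, coeff n (monomial m (1 : K) * q m) =
        if m ≤ n ∧ c n = m then coeff n f else 0 := by
      intro m
      rw [coeff_monomial_mul, one_mul]
      by_cases hmn : m ≤ n
      · rw [if_pos hmn]
        change (if c (m + (n - m)) = m then coeff (m + (n - m)) f else 0) = _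
        rw [add_tsub_cancel_of_le hmn]
        simp only [hmn, true_and]
      · simp [hmn]
    rw [map_sum, Finset.sum_congr rfl fun m _ => coeff_term m]
    rcases lt_or_ge n.degree j with hn | hn
    · simp [hf n hn]
    · obtain ⟨hle, hdeg⟩ := hc n hn
      rw [Finset.sum_eq_single (c n) (fun m _ hm => if_neg fun h => hm h.2.symm)
        fun h => absurd (by simpa using hdeg) h, if_pos ⟨hle, rfl⟩]
  rw [f_eq_sum]
  refine Ideal.sum_mem _ fun m hm => Ideal.mul_mem_right _ _ ?_
  have hdeg : m.degree = j := by simpa using hm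
  exact hdeg ▸ monomial_mem_maximalIdeal_pow_degree m

theorem sub_sum_coeff_smul_monomial_mem_maximalIdeal_pow (j : ℕ) (f : MvPowerSeries σ K) :
    f - ∑ n ∈ (Finsupp.finite_of_degree_lt j).toFinset, coeff n f • monomial n (1 : K) ∈
      maximalIdeal (MvPowerSeries σ K) ^ j := by
  classical
  rw [mem_maximalIdeal_pow_iff_coeff_eq_zero]
  intro n hn
  simp [coeff_monomial, hn]

theorem mk_maximalIdeal_pow_eq_sum (j : ℕ) (f : MvPowerSeries σ K) :
    Ideal.Quotient.mk (maximalIdeal (MvPowerSeries σ K) ^ j) f =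
      ∑ n ∈ (Finsupp.finite_of_degree_lt j).toFinset,
        coeff n f • Ideal.Quotient.mk (maximalIdeal (MvPowerSeries σ K) ^ j) (monomial n 1) := by
  have mk_eq := Ideal.Quotient.eq.2 (sub_sum_coeff_smul_monomial_mem_maximalIdeal_pow j f)
  simpa only [← Ideal.Quotient.mkₐ_eq_mk K, map_sum, map_smul] using mk_eq

instance finiteDimensional_quotient_maximalIdeal_pow (j : ℕ) :
    FiniteDimensional K (MvPowerSeries σ K ⧸ maximalIdeal (MvPowerSeries σ K) ^ j) := by
  classical
  refine ⟨⟨(Finsupp.finite_of_degree_lt j).toFinset.image fun n =>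
    Ideal.Quotient.mk _ (monomial n 1), eq_top_iff.2 fun x _ => ?_⟩⟩
  obtain ⟨f, rfl⟩ := Ideal.Quotient.mk_surjective x
  rw [mk_maximalIdeal_pow_eq_sum]
  exact Submodule.sum_mem _ fun n hn => Submodule.smul_mem _ _
    (Submodule.subset_span (Finset.mem_coe.2 (Finset.mem_image_of_mem _ hn)))

theorem coeff_algHom_apply (ψ : MvPowerSeries σ K →ₐ[K] MvPowerSeries σ K) (n : σ →₀ ℕ)
    (f : MvPowerSeries σ K) :
    coeff n (ψ f) = ∑ m ∈ (Finsupp.finite_of_degree_lt (n.degree + 1)).toFinset,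
      coeff m f * coeff n (ψ (monomial m 1)) := by
  have sub_mem := Ideal.mem_map_of_mem ψ
    (sub_sum_coeff_smul_monomial_mem_maximalIdeal_pow (n.degree + 1) f)
  rw [Ideal.map_pow] at sub_mem
  have coeff_sub := mem_maximalIdeal_pow_iff_coeff_eq_zero.1
    (Ideal.pow_right_mono (map_maximalIdeal_le_of_algHom ψ) _ sub_mem) n n.degree.lt_succ_self
  simpa [sub_eq_zero] using coeff_sub

end PowerSeries

section RegularFamilies

open MvPowerSeries IsLocalRing

variable {σ K Λ : Type*} [Field K]

/-- The families of power series, indexed by `Λ`, all of whose coefficients lie in the algebra `R`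
of functions on `Λ`. -/
def regularSections (σ : Type*) (R : Subalgebra K (Λ → K)) :
    Subalgebra K (Λ → MvPowerSeries σ K) where
  carrier := {f | ∀ n, (fun a => coeff n (f a)) ∈ R}
  mul_mem' {f g} hf hg n := by
    classical
    have coeff_mul_eq : (fun a => coeff n ((f * g) a)) =
        ∑ p ∈ Finset.HasAntidiagonal.antidiagonal n,
          (fun a => coeff p.1 (f a)) * fun a => coeff p.2 (g a) := by
      ext a
      simp [coeff_mul]
    rw [coeff_mul_eq]
    exact R.sum_mem fun p _ => R.mul_mem (hf p.1) (hg p.2)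
  add_mem' hf hg n := by simpa [Pi.add_def] using R.add_mem (hf n) (hg n)
  algebraMap_mem' c n := R.algebraMap_mem (coeff n (algebraMap K (MvPowerSeries σ K) c))

theorem const_mem_regularSections (R : Subalgebra K (Λ → K)) (f : MvPowerSeries σ K) :
    (fun _ => f) ∈ regularSections σ R := fun n => R.algebraMap_mem (coeff n f)

/-- Composition with a map `π` of parameters, as a homomorphism of algebras of functions. -/
def precompAlgHom (K : Type*) [Field K] {Λ Λ' : Type*} (π : Λ' → Λ) :
    (Λ → K) →ₐ[K] (Λ' → K) :=
  AlgHom.pi fun a => Pi.evalAlgHom K (fun _ => K) (π a)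

/-- A family `ψ` of endomorphisms of the algebra of power series is `R`-regular if every fixed
power series is mapped to a family whose coefficients lie in the algebra `R` of functions of the
parameter. -/
def IsRegularFamily (R : Subalgebra K (Λ → K))
    (ψ : Λ → MvPowerSeries σ K →ₐ[K] MvPowerSeries σ K) : Prop :=
  ∀ f, (fun a => ψ a f) ∈ regularSections σ R

namespace IsRegularFamily

variable {R : Subalgebra K (Λ → K)} {ψ : Λ → MvPowerSeries σ K →ₐ[K] MvPowerSeries σ K}

theorem mono {R' : Subalgebra K (Λ → K)} (hψ : IsRegularFamily R ψ) (hR : R ≤ R') :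
    IsRegularFamily R' ψ := fun f n => hR (hψ f n)

theorem comp_param {Λ' : Type*} (hψ : IsRegularFamily R ψ) (π : Λ' → Λ) :
    IsRegularFamily (R.map (precompAlgHom K π)) fun a => ψ (π a) :=
  fun f n => ⟨_, hψ f n, rfl⟩

theorem exists_section_of_mem_sup (hψ : IsRegularFamily R ψ) {I J : Ideal (MvPowerSeries σ K)}
    {a : Λ} {x : MvPowerSeries σ K} (hx : x ∈ I.map (ψ a) ⊔ J) :
    ∃ f ∈ regularSections σ R, f a = x ∧ ∀ b, f b ∈ I.map (ψ b) ⊔ J := by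
  have of_mem_map : ∀ y ∈ I.map (ψ a),
      ∃ f ∈ regularSections σ R, f a = y ∧ ∀ b, f b ∈ I.map (ψ b) := by
    intro y hy
    refine Submodule.span_induction ?_ ?_ ?_ ?_ hy
    · rintro _ ⟨f, hf, rfl⟩
      exact ⟨fun b => ψ b f, hψ f, rfl, fun b => Ideal.mem_map_of_mem _ hf⟩
    · exact ⟨0, zero_mem _, rfl, fun b => zero_mem _⟩
    · rintro _ _ - - ⟨f, hf, rfl, hfI⟩ ⟨g, hg, rfl, hgI⟩
      exact ⟨f + g, add_mem hf hg, rfl, fun b => add_mem (hfI b) (hgI b)⟩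
    · rintro u _ - ⟨f, hf, rfl, hfI⟩
      exact ⟨(fun _ => u) * f, mul_mem (const_mem_regularSections R u) hf, rfl,
        fun b => Ideal.mul_mem_left _ u (hfI b)⟩
  obtain ⟨y, hy, z, hz, rfl⟩ := Submodule.mem_sup.1 hx
  obtain ⟨f, hf, rfl, hfI⟩ := of_mem_map y hy
  exact ⟨f + fun _ => z, add_mem hf (const_mem_regularSections R z), rfl,
    fun b => Submodule.add_mem_sup (hfI b) hz⟩

variable [Finite σ]

theorem apply_mem (hψ : IsRegularFamily R ψ) {f : Λ → MvPowerSeries σ K}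
    (hf : f ∈ regularSections σ R) : (fun a => ψ a (f a)) ∈ regularSections σ R := by
  intro n
  have coeff_eq : (fun a => coeff n (ψ a (f a))) =
      ∑ m ∈ (Finsupp.finite_of_degree_lt (n.degree + 1)).toFinset,
        (fun a => coeff m (f a)) * fun a => coeff n (ψ a (monomial m 1)) := by
    ext a
    simp [coeff_algHom_apply (ψ a) n (f a)]
  rw [coeff_eq]
  exact R.sum_mem fun m _ => R.mul_mem (hf m) (hψ _ n)

theorem comp {φ : Λ → MvPowerSeries σ K →ₐ[K] MvPowerSeries σ K}
    (hφ : IsRegularFamily R φ) (hψ : IsRegularFamily R ψ) :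
    IsRegularFamily R fun a => (φ a).comp (ψ a) := fun f => hφ.apply_mem (hψ f)

theorem of_X (hX : ∀ i, (fun a => ψ a (X i)) ∈ regularSections σ R) : IsRegularFamily R ψ := by
  have coe_mem : ∀ p : MvPolynomial σ K, (fun a => ψ a p) ∈ regularSections σ R := by
    intro p
    induction p using MvPolynomial.induction_on with
    | C c =>
      convert const_mem_regularSections R (C c : MvPowerSeries σ K) using 2 with a
      simpa [MvPowerSeries.algebraMap_apply] using (ψ a).commutes c
    | add p q hp hq => simpa [Pi.add_def] using (regularSections σ R).add_mem hp hq
    | mul_X p i hp => simpa [Pi.mul_def] using (regularSections σ R).mul_mem hp (hX i)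
  intro f n
  have coeff_eq : (fun a => coeff n (ψ a f)) =
      ∑ m ∈ (Finsupp.finite_of_degree_lt (n.degree + 1)).toFinset,
        coeff m f • fun a => coeff n (ψ a (monomial m 1)) := by
    ext a
    simp [coeff_algHom_apply (ψ a) n f]
  rw [coeff_eq]
  exact R.sum_mem fun m _ => R.smul_mem
    (by simpa using coe_mem (MvPolynomial.monomial m 1) n) _

theorem isZariskiOpen_rank_quotient_le (hψ : IsRegularFamily R ψ)
    (I J : Ideal (MvPowerSeries σ K)) (k : ℕ) :
    IsZariskiOpen R {a | Module.rank K (MvPowerSeries σ K ⧸ (I.map (ψ a) ⊔ J)) ≤ k} := by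
  intro a ha
  obtain ⟨s, hs, hli⟩ := (rank_quotient_le_iff_exists_linearIndependent _ k).1 ha
  choose f hf hfa hfI using fun i => hψ.exists_section_of_mem_sup (hs i)
  have dual_mem : ∀ (ℓ : Module.Dual K (MvPowerSeries σ K ⧸ maximalIdeal _ ^ (k + 1))) i,
      (fun b => ℓ (Ideal.Quotient.mk _ (f i b))) ∈ R := by
    intro ℓ i
    have ℓ_eq : (fun b => ℓ (Ideal.Quotient.mk _ (f i b))) =
        ∑ n ∈ (Finsupp.finite_of_degree_lt (k + 1)).toFinset,
          ℓ (Ideal.Quotient.mk _ (monomial n 1)) • fun b => coeff n (f i b) := by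
      ext b
      simp [mk_maximalIdeal_pow_eq_sum (k + 1) (f i b), mul_comm]
    rw [ℓ_eq]
    exact R.sum_mem fun n _ => R.smul_mem (hf i n) _
  obtain ⟨r, hr, hra, hrb⟩ := isZariskiOpen_linearIndependent
    (fun b i => Ideal.Quotient.mk (maximalIdeal _ ^ (k + 1)) (f i b)) dual_mem a
    (by simpa only [Set.mem_ofPred_eq, hfa] using hli)
  exact ⟨r, hr, hra, fun b hb => (rank_quotient_le_iff_exists_linearIndependent _ k).2
    ⟨fun i => f i b, fun i => hfI i b, hrb b hb⟩⟩

theorem exists_forall_rank_quotient_le [IsNoetherianRing R] (hψ : IsRegularFamily R ψ)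
    (I J : Ideal (MvPowerSeries σ K)) :
    ∃ m : ℕ, ∀ a, Module.rank K (MvPowerSeries σ K ⧸ (I.map (ψ a) ⊔ J)) < Cardinal.aleph0 →
      Module.rank K (MvPowerSeries σ K ⧸ (I.map (ψ a) ⊔ J)) ≤ m := by
  obtain ⟨m, hm⟩ := IsZariskiOpen.exists_forall_subset_of_monotone
    (U := fun k : ℕ => {a | Module.rank K (MvPowerSeries σ K ⧸ (I.map (ψ a) ⊔ J)) ≤ k})
    (fun k l hkl => Set.ofPred_subset_ofPred.2 fun a ha => ha.trans (Nat.cast_le.2 hkl))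
    (hψ.isZariskiOpen_rank_quotient_le I J)
  refine ⟨m, fun a ha => ?_⟩
  obtain ⟨k, hk⟩ := Cardinal.lt_aleph0.1 ha
  exact hm k hk.le

end IsRegularFamily

end RegularFamilies

section RegularityCriterion

open MvPowerSeries IsLocalRing

variable {σ K Λ : Type*} [Field K]

/-- The square of the maximal ideal of `K[[x]]`, as a linear subspace. -/
noncomputable def maximalIdealSq (σ K : Type*) [Field K] : Submodule K (MvPowerSeries σ K) :=
  (maximalIdeal (MvPowerSeries σ K) ^ 2).restrictScalars K

instance [Finite σ] : FiniteDimensional K (MvPowerSeries σ K ⧸ maximalIdealSq σ K) :=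
  Module.Finite.equiv (Submodule.Quotient.restrictScalarsEquiv K _).symm

theorem maximalIdealSq_le_comap_algHom (ψ : MvPowerSeries σ K →ₐ[K] MvPowerSeries σ K) :
    maximalIdealSq σ K ≤ (maximalIdealSq σ K).comap ψ.toLinearMap := by
  intro f hf
  have map_mem := Ideal.mem_map_of_mem ψ (show f ∈ maximalIdeal (MvPowerSeries σ K) ^ 2 from hf)
  rw [Ideal.map_pow] at map_mem
  exact Ideal.pow_right_mono (map_maximalIdeal_le_of_algHom ψ) 2 map_mem

theorem coeff_apply_mem_of_mem_maximalIdealSq {R : Subalgebra K (Λ → K)}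
    {ψ : Λ → MvPowerSeries σ K →ₐ[K] MvPowerSeries σ K} {n : σ →₀ ℕ}
    (ih : ∀ i : σ →₀ ℕ, i.degree < n.degree → ∀ f, (fun a => coeff i (ψ a f)) ∈ R)
    {f : MvPowerSeries σ K} (hf : f ∈ maximalIdealSq σ K) :
    (fun a => coeff n (ψ a f)) ∈ R := by
  classical
  have coeff_zero : ∀ u ∈ maximalIdeal (MvPowerSeries σ K), ∀ a, coeff 0 (ψ a u) = 0 :=
    fun u hu a => mem_maximalIdeal_iff_constantCoeff_eq_zero.1
      (map_maximalIdeal_le_of_algHom (ψ a) (Ideal.mem_map_of_mem _ hu))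
  have mem_mul : f ∈ maximalIdeal (MvPowerSeries σ K) * maximalIdeal (MvPowerSeries σ K) := by
    rw [← pow_two]
    exact hf
  refine Submodule.mul_induction_on mem_mul
    (fun u hu v hv => ?_) fun u v hu hv => by simpa [Pi.add_def] using R.add_mem hu hv
  have coeff_eq : (fun a => coeff n (ψ a (u * v))) =
      ∑ p ∈ Finset.HasAntidiagonal.antidiagonal n,
        (fun a => coeff p.1 (ψ a u)) * fun a => coeff p.2 (ψ a v) := by
    ext a
    simp [coeff_mul]
  rw [coeff_eq]
  refine R.sum_mem fun ⟨i, j⟩ hij => ?_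
  have degree_add : i.degree + j.degree = n.degree := by
    rw [← Finset.HasAntidiagonal.mem_antidiagonal.1 hij, map_add]
  rcases eq_or_ne i 0 with rfl | hi
  · simpa only [coeff_zero u hu, ← Pi.zero_def, zero_mul] using R.zero_mem
  rcases eq_or_ne j 0 with rfl | hj
  · simpa only [coeff_zero v hv, ← Pi.zero_def, mul_zero] using R.zero_mem
  · have hi' : i.degree ≠ 0 := fun h => hi ((Finsupp.degree_eq_zero_iff i).1 h)
    have hj' : j.degree ≠ 0 := fun h => hj ((Finsupp.degree_eq_zero_iff j).1 h)
    exact R.mul_mem (ih i (by omega) u) (ih j (by omega) v)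

theorem IsRegularFamily.of_forall_hasEigenvalue [IsAlgClosed K] [Finite σ]
    {R : Subalgebra K (Λ → K)} {ψ : Λ → MvPowerSeries σ K →ₐ[K] MvPowerSeries σ K}
    (T : Module.End K (MvPowerSeries σ K))
    (hT : maximalIdealSq σ K ≤ (maximalIdealSq σ K).comap T)
    (hR : ∀ s, Module.End.HasEigenvalue ((maximalIdealSq σ K).mapQ _ T hT) s → ∀ f n,
      (fun a => coeff n (ψ a (T f - s • f))) ∈ R → (fun a => coeff n (ψ a f)) ∈ R) :
    IsRegularFamily R ψ := by
  suffices h : ∀ (k : ℕ) (n : σ →₀ ℕ), n.degree = k → ∀ f, (fun a => coeff n (ψ a f)) ∈ R from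
    fun f n => h _ n rfl f
  intro k
  induction k using Nat.strong_induction_on with
  | _ k ih =>
    rintro n rfl f
    let C : Submodule K (MvPowerSeries σ K) :=
      R.toSubmodule.comap (LinearMap.pi fun a => coeff n ∘ₗ (ψ a).toLinearMap)
    have sq_le : maximalIdealSq σ K ≤ C := fun f hf =>
      coeff_apply_mem_of_mem_maximalIdealSq (fun i hi => ih _ hi i rfl) hf
    have C_eq_top : C = ⊤ := eq_top_of_le_of_forall_hasEigenvalue_mapQ T hT sq_le
      fun s hs f hf => hR s hs f n hf
    exact C_eq_top.ge (Submodule.mem_top : f ∈ ⊤)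

end RegularityCriterion

section QuasiPolynomials

variable {K P : Type*} [Field K] [AddCommGroup P]

/-- The algebra of quasi-polynomials on the group `P`: the functions generated by an additive
coordinate `ι` and by the characters ("exponentials") in `S`. -/
def quasiPolynomials (ι : P →+ K) (S : Set (AddChar P K)) : Subalgebra K (P → K) :=
  Algebra.adjoin K (insert ⇑ι ((⇑) '' S))

/-- The quasi-monomial `t ↦ χ(t) ι(t) ^ j`. -/
def quasiMonomial (ι : P →+ K) (χ : AddChar P K) (j : ℕ) : P → K := fun t => χ t * ι t ^ j

variable {ι : P →+ K} {S : Set (AddChar P K)}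

theorem quasiPolynomials_fg (hS : S.Finite) : (quasiPolynomials ι S).FG :=
  Subalgebra.fg_def.2 ⟨_, (hS.image _).insert _, rfl⟩

theorem quasiMonomial_mem {χ : AddChar P K} (hχ : χ ∈ Submonoid.closure S) (j : ℕ) :
    quasiMonomial ι χ j ∈ quasiPolynomials ι S := by
  have χ_mem : ⇑χ ∈ quasiPolynomials ι S := by
    induction hχ using Submonoid.closure_induction with
    | mem χ hχ => exact Algebra.subset_adjoin (Set.mem_insert_of_mem _ ⟨χ, hχ, rfl⟩)
    | one => simp
    | mul χ χ' _ _ h h' => simpa using (quasiPolynomials ι S).mul_mem h h'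
  exact (quasiPolynomials ι S).mul_mem χ_mem
    ((quasiPolynomials ι S).pow_mem (Algebra.subset_adjoin (Set.mem_insert _ _)) j)

theorem quasiPolynomials_le_of_forall_quasiMonomial_mem {D : Submodule K (P → K)}
    (hD : ∀ χ ∈ Submonoid.closure S, ∀ j, quasiMonomial ι χ j ∈ D) :
    (quasiPolynomials ι S).toSubmodule ≤ D := by
  have closure_le : ∀ f ∈ Submonoid.closure (insert ⇑ι ((⇑) '' S)),
      ∃ χ ∈ Submonoid.closure S, ∃ j, f = quasiMonomial ι χ j := by
    intro f hf
    induction hf using Submonoid.closure_induction with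
    | mem f hf =>
      rcases hf with rfl | ⟨χ, hχ, rfl⟩
      · exact ⟨1, one_mem _, 1, by ext; simp [quasiMonomial]⟩
      · exact ⟨χ, Submonoid.subset_closure hχ, 0, by ext; simp [quasiMonomial]⟩
    | one => exact ⟨1, one_mem _, 0, by ext; simp [quasiMonomial]⟩
    | mul f g _ _ hf hg =>
      obtain ⟨χ, hχ, i, rfl⟩ := hf
      obtain ⟨χ', hχ', j, rfl⟩ := hg
      exact ⟨χ * χ', mul_mem hχ hχ', i + j, by
        ext
        simp only [quasiMonomial, Pi.mul_apply, AddChar.mul_apply]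
        ring⟩
  rw [quasiPolynomials, Algebra.adjoin_eq_span, Submodule.span_le]
  intro f hf
  obtain ⟨χ, hχ, j, rfl⟩ := closure_le f hf
  exact hD χ hχ j

-- `L` is a linear relation, not an operator, so as to cover `d/dt - s`, which is not everywhere
-- defined on functions.
theorem mem_quasiPolynomials_of_mem_relation (L : Submodule K ((P → K) × (P → K)))
    (hL : ∀ χ ∈ Submonoid.closure S, ∃ (α : K) (β : ℕ → K), (∀ j, β j ≠ 0) ∧
      (quasiMonomial ι χ 0, α • quasiMonomial ι χ 0) ∈ L ∧
      ∀ j, ∃ w ∈ Submodule.span K (quasiMonomial ι χ '' Set.Iio j),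
        (quasiMonomial ι χ (j + 1),
          α • quasiMonomial ι χ (j + 1) + (β j • quasiMonomial ι χ j + w)) ∈ L)
    (hker : ∀ c, (c, 0) ∈ L → c ∈ quasiPolynomials ι S)
    {a b : P → K} (hab : (a, b) ∈ L) (hb : b ∈ quasiPolynomials ι S) :
    a ∈ quasiPolynomials ι S := by
  let D : Submodule K (P → K) :=
    (L ⊓ (quasiPolynomials ι S).toSubmodule.comap (LinearMap.fst K _ _)).map (LinearMap.snd K _ _)
  have monomial_mem : ∀ χ ∈ Submonoid.closure S, ∀ j, quasiMonomial ι χ j ∈ D := by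
    intro χ hχ
    obtain ⟨α, β, hβ, h0, hsucc⟩ := hL χ hχ
    refine mem_of_forall_smul_succ_add_mem D _ α β hβ ⟨_, ⟨h0, quasiMonomial_mem hχ 0⟩, rfl⟩
      fun j => ?_
    obtain ⟨w, hw, h⟩ := hsucc j
    exact ⟨w, hw, _, ⟨h, quasiMonomial_mem hχ (j + 1)⟩, rfl⟩
  obtain ⟨⟨a', b'⟩, ⟨ha'L, ha'⟩, rfl⟩ :=
    quasiPolynomials_le_of_forall_quasiMonomial_mem monomial_mem hb
  have sub_mem : a - a' ∈ quasiPolynomials ι S :=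
    hker _ (by simpa using L.sub_mem hab ha'L)
  simpa using (quasiPolynomials ι S).add_mem sub_mem ha'

end QuasiPolynomials

section Integration

theorem mem_quasiPolynomials_of_shift_sub_mem {K : Type*} [Field K] [CharZero K]
    {S : Set (AddChar ℤ K)} {χ : AddChar ℤ K} (hχ : χ ∈ S) {a : ℤ → K}
    (ha : (fun k => a (k + 1) - χ 1 * a k) ∈ quasiPolynomials (Int.castAddHom K) S) :
    a ∈ quasiPolynomials (Int.castAddHom K) S := by
  let Δ : Module.End K (ℤ → K) := LinearMap.funLeft K K (· + 1) - χ 1 • 1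
  have Δ_apply : ∀ f k, Δ f k = f (k + 1) - χ 1 * f k := fun f k => rfl
  refine mem_quasiPolynomials_of_mem_relation Δ.graph (fun ξ _ => ?_) (fun c hc => ?_)
    (b := Δ a) rfl ha
  · refine ⟨ξ 1 - χ 1, fun j => ξ 1 * (j + 1 : ℕ),
      fun j => mul_ne_zero (ξ.val_isUnit 1).ne_zero (Nat.cast_ne_zero.2 j.succ_ne_zero), ?_,
      fun j => ?_⟩
    · ext k
      simp only [Δ_apply, quasiMonomial, AddChar.map_add_eq_mul, pow_zero, mul_one,
        Pi.smul_apply, smul_eq_mul]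
      ring
    · refine ⟨∑ i ∈ Finset.range j, (ξ 1 * (j + 1).choose i) •
        quasiMonomial (Int.castAddHom K) ξ i, ?_, ?_⟩
      · exact Submodule.sum_mem _ fun i hi => Submodule.smul_mem _ _
          (Submodule.subset_span ⟨i, Finset.mem_range.1 hi, rfl⟩)
      · ext k
        simp only [Δ_apply, quasiMonomial, Int.coe_castAddHom, Int.cast_add, Int.cast_one,
          AddChar.map_add_eq_mul, add_pow, one_pow, mul_one, Finset.sum_range_succ,
          Nat.choose_self, Nat.choose_succ_self_right, Pi.add_apply, Pi.smul_apply, smul_eq_mul,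
          Finset.sum_apply, mul_add, Finset.mul_sum, mul_left_comm]
        push_cast
        ring_nf
  · have c_succ : ∀ k, c (k + 1) = χ 1 * c k := fun k =>
      sub_eq_zero.1 (congrFun ((LinearMap.mem_graph_iff Δ (c, 0)).1 hc) k).symm
    have c_eq : c = c 0 • quasiMonomial (Int.castAddHom K) χ 0 := by
      ext k
      simp only [quasiMonomial, pow_zero, mul_one, Pi.smul_apply, smul_eq_mul]
      induction k using Int.induction_on with
      | zero => simp
      | succ k ih => rw [c_succ, ih, AddChar.map_add_eq_mul]; ring
      | pred k ih =>
        refine mul_left_cancel₀ (χ.val_isUnit 1).ne_zero ?_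
        rw [← c_succ, mul_left_comm, ← AddChar.map_add_eq_mul]
        simpa using ih
    rw [c_eq]
    exact Subalgebra.smul_mem _ (quasiMonomial_mem (Submonoid.subset_closure hχ) 0) _

/-- The character `t ↦ exp (s t)` of the additive group of the complex numbers. -/
noncomputable def expChar (s : ℂ) : AddChar ℂ ℂ where
  toFun t := Complex.exp (s * t)
  map_zero_eq_one' := by simp
  map_add_eq_mul' t u := by rw [mul_add, Complex.exp_add]

theorem expChar_apply (s t : ℂ) : expChar s t = Complex.exp (s * t) := rfl

theorem hasDerivAt_expChar (s t : ℂ) : HasDerivAt (expChar s) (s * expChar s t) t :=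
  ((hasDerivAt_id t).const_mul s).cexp.congr_deriv (by simp [expChar_apply, mul_comm])

/-- The graph of the operator `d/dt - s` on functions of a complex variable. -/
def derivSubGraph (s : ℂ) : Submodule ℂ ((ℂ → ℂ) × (ℂ → ℂ)) where
  carrier := {p | ∀ t, HasDerivAt p.1 (p.2 t + s * p.1 t) t}
  zero_mem' t := by simp
  add_mem' hp hq t := ((hp t).add (hq t)).congr_deriv (by
    simp only [Prod.fst_add, Prod.snd_add, Pi.add_apply]
    ring)
  smul_mem' c p hp t := ((hp t).const_mul c).congr_deriv (by
    simp only [Prod.smul_fst, Prod.smul_snd, Pi.smul_apply, smul_eq_mul]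
    ring)

theorem mem_quasiPolynomials_of_hasDerivAt {S : Set ℂ} {s : ℂ} (hs : s ∈ S) {a b : ℂ → ℂ}
    (hab : ∀ t, HasDerivAt a (b t) t)
    (ha : (fun t => b t - s * a t) ∈ quasiPolynomials (AddMonoidHom.id ℂ) (expChar '' S)) :
    a ∈ quasiPolynomials (AddMonoidHom.id ℂ) (expChar '' S) := by
  refine mem_quasiPolynomials_of_mem_relation (derivSubGraph s) (fun ξ hξ => ?_) (fun c hc => ?_)
    (fun t => by simpa using hab t) ha
  · obtain ⟨r, rfl⟩ : ξ ∈ Set.range expChar := by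
      induction hξ using Submonoid.closure_induction with
      | mem ξ hξ => exact Set.image_subset_range _ _ hξ
      | one => exact ⟨0, by ext; simp [expChar_apply]⟩
      | mul ξ ξ' _ _ h h' =>
        obtain ⟨r, rfl⟩ := h
        obtain ⟨r', rfl⟩ := h'
        exact ⟨r + r', by ext; simp [expChar_apply, add_mul, Complex.exp_add]⟩
    refine ⟨r - s, fun j => (j + 1 : ℕ), fun j => Nat.cast_ne_zero.2 j.succ_ne_zero, fun t => ?_,
      fun j => ⟨0, zero_mem _, fun t => ?_⟩⟩
    · refine (((hasDerivAt_expChar r t).mul_const 1).congr_deriv ?_)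
      simp only [quasiMonomial, pow_zero, mul_one, Pi.smul_apply, smul_eq_mul]
      ring
    · refine ((hasDerivAt_expChar r t).mul (hasDerivAt_pow (j + 1) t)).congr_deriv ?_
      simp only [quasiMonomial, AddMonoidHom.id_apply, add_tsub_cancel_right, add_zero,
        Pi.add_apply, Pi.smul_apply, smul_eq_mul]
      ring
  · have deriv_eq_zero : ∀ t, HasDerivAt (fun t => c t * expChar (-s) t) 0 t := fun t =>
      ((hc t).mul (hasDerivAt_expChar (-s) t)).congr_deriv (by simp only [Pi.zero_apply]; ring)
    have c_eq : c = c 0 • quasiMonomial (AddMonoidHom.id ℂ) (expChar s) 0 := by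
      ext t
      have const := is_const_of_deriv_eq_zero (fun t => (deriv_eq_zero t).differentiableAt)
        (fun t => (deriv_eq_zero t).deriv) t 0
      rw [AddChar.map_zero_eq_one, mul_one] at const
      simp [quasiMonomial, ← const, expChar_apply, mul_assoc, ← Complex.exp_add]
    rw [c_eq]
    exact Subalgebra.smul_mem _
      (quasiMonomial_mem (Submonoid.subset_closure (Set.mem_image_of_mem _ hs)) 0) _

end Integration

section OneParameterGroups

open MvPowerSeries Multiplicative

variable {σ : Type*} [Finite σ]

theorem exists_isRegularFamily_of_int {K : Type*} [Field K] [IsAlgClosed K] [CharZero K]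
    (Ψ : Multiplicative ℤ →* (MvPowerSeries σ K →ₐ[K] MvPowerSeries σ K)) :
    ∃ S : Set (AddChar ℤ K), S.Finite ∧
      IsRegularFamily (quasiPolynomials (Int.castAddHom K) S) fun k => Ψ (ofAdd k) := by
  let T := (Ψ (ofAdd 1)).toLinearMap
  have hT : maximalIdealSq σ K ≤ (maximalIdealSq σ K).comap T := maximalIdealSq_le_comap_algHom _
  let T' : Module.End K (MvPowerSeries σ K ⧸ maximalIdealSq σ K) :=
    (maximalIdealSq σ K).mapQ _ T hT
  have T'_surjective : Function.Surjective T' := by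
    intro q
    obtain ⟨f, rfl⟩ := Submodule.mkQ_surjective _ q
    refine ⟨Submodule.mkQ _ (Ψ (ofAdd (-1)) f), congrArg (Submodule.mkQ _) ?_⟩
    change (Ψ (ofAdd 1) * Ψ (ofAdd (-1))) f = f
    rw [← map_mul, ← ofAdd_add, add_neg_cancel, ofAdd_zero, map_one, AlgHom.one_apply]
  refine ⟨{χ | T'.HasEigenvalue (χ 1)}, ?_, ?_⟩
  · refine (Module.End.finite_hasEigenvalue T').preimage fun χ _ χ' _ h => ?_
    ext k
    simpa [← AddChar.map_zsmul_eq_zpow] using congrArg (· ^ k) (show χ 1 = χ' 1 from h)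
  · refine .of_forall_hasEigenvalue T hT fun s hs f n hf => ?_
    have s_ne_zero : s ≠ 0 := by
      rintro rfl
      obtain ⟨v, hv, hv0⟩ := hs.exists_hasEigenvector
      refine hv0 (LinearMap.injective_iff_surjective.2 T'_surjective ?_)
      rw [Module.End.mem_eigenspace_iff.1 hv, zero_smul, map_zero]
    let χ : AddChar ℤ K := AddChar.toMonoidHomEquiv.symm
      ((Units.coeHom K).comp (zpowersHom Kˣ (Units.mk0 s s_ne_zero)))
    have χ_one : χ 1 = s := by simp [χ]
    refine mem_quasiPolynomials_of_shift_sub_mem (χ := χ) (by rw [← χ_one] at hs; exact hs) ?_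
    convert hf using 2 with k
    simp [χ_one, T, ofAdd_add]

/-- The infinitesimal generator `d/dt ψ_t |_{t = 0}` of a family `ψ_t` of endomorphisms of
`ℂ[[x]]`, the derivative being taken coefficient by coefficient. -/
noncomputable def infinitesimalGenerator {ψ : ℂ → MvPowerSeries σ ℂ →ₐ[ℂ] MvPowerSeries σ ℂ}
    (hψ : ∀ f n, DifferentiableAt ℂ (fun t => coeff n (ψ t f)) 0) :
    Module.End ℂ (MvPowerSeries σ ℂ) where
  toFun f n := deriv (fun t => coeff n (ψ t f)) 0
  map_add' f g := by
    simp only [map_add]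
    exact funext fun n => deriv_fun_add (hψ f n) (hψ g n)
  map_smul' c f := by
    simp only [map_smul]
    exact funext fun n => deriv_const_smul c (hψ f n)

section

variable {Ψ : Multiplicative ℂ →* (MvPowerSeries σ ℂ →ₐ[ℂ] MvPowerSeries σ ℂ)}
  (hΨ : ∀ f n, DifferentiableAt ℂ (fun t => coeff n (Ψ (ofAdd t) f)) 0)

include hΨ

theorem hasDerivAt_coeff_apply (f : MvPowerSeries σ ℂ) (n : σ →₀ ℕ) (t : ℂ) :
    HasDerivAt (fun u => coeff n (Ψ (ofAdd u) f))
      (coeff n (Ψ (ofAdd t) (infinitesimalGenerator hΨ f))) t := by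
  have coeff_eq : ∀ u, coeff n (Ψ (ofAdd u) f) =
      ∑ m ∈ (Finsupp.finite_of_degree_lt (n.degree + 1)).toFinset,
        coeff m (Ψ (ofAdd (u - t)) f) * coeff n (Ψ (ofAdd t) (monomial m 1)) := by
    intro u
    rw [← coeff_algHom_apply, ← AlgHom.mul_apply, ← map_mul, ← ofAdd_add, add_sub_cancel]
  simp only [coeff_eq]
  rw [coeff_algHom_apply]
  refine HasDerivAt.fun_sum fun m _ => HasDerivAt.mul_const ?_ _
  have hasDerivAt_zero : HasDerivAt (fun u => coeff m (Ψ (ofAdd u) f))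
      (coeff m (infinitesimalGenerator hΨ f)) (t - t) := by
    rw [sub_self]
    exact (hΨ f m).hasDerivAt
  exact hasDerivAt_zero.comp_sub_const t t

theorem maximalIdealSq_le_comap_infinitesimalGenerator :
    maximalIdealSq σ ℂ ≤ (maximalIdealSq σ ℂ).comap (infinitesimalGenerator hΨ) := by
  intro f hf
  refine (mem_maximalIdeal_pow_iff_coeff_eq_zero (K := ℂ) (j := 2)).2 fun n hn => ?_
  have coeff_eq_zero : ∀ t, coeff n (Ψ (ofAdd t) f) = 0 := fun t =>
    mem_maximalIdeal_pow_iff_coeff_eq_zero.1 (maximalIdealSq_le_comap_algHom (Ψ (ofAdd t)) hf) n hn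
  change deriv (fun t => coeff n (Ψ (ofAdd t) f)) 0 = 0
  simp only [coeff_eq_zero, deriv_const]

theorem exists_isRegularFamily_of_differentiableAt :
    ∃ S : Set ℂ, S.Finite ∧ IsRegularFamily
      (quasiPolynomials (AddMonoidHom.id ℂ) (expChar '' S)) fun t => Ψ (ofAdd t) := by
  have hδ := maximalIdealSq_le_comap_infinitesimalGenerator hΨ
  refine ⟨_, Module.End.finite_hasEigenvalue ((maximalIdealSq σ ℂ).mapQ _ _ hδ),
    .of_forall_hasEigenvalue _ hδ fun s hs f n hf => ?_⟩
  refine mem_quasiPolynomials_of_hasDerivAt hs (hasDerivAt_coeff_apply hΨ f n) ?_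
  simpa using hf

end

end OneParameterGroups

section ParametrizedSubgroups

open MvPowerSeries Multiplicative

variable {d : ℕ}

theorem pullback_mul_eq_comp (g h : FormalDiff d) :
    (g * h).val.pullback = h.val.pullback.comp g.val.pullback :=
  AlgHom.ext (FormalSelfMap.pullback_mul g.val h.val)

theorem FormalSelfMap.pullback_X (F : FormalSelfMap d) (i : Fin d) :
    F.pullback (X i) = F.comp i := by
  rw [pullback_apply, subst_X F.hasSubst]

/-- The homomorphism `t ↦ (φ t)^*` attached to a one-parameter group `φ`. Pulling back reverses
products, which is harmless as the group of parameters is commutative. -/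
noncomputable def pullbackHom {P : Type*} [AddCommGroup P] (φ : Multiplicative P →* FormalDiff d) :
    Multiplicative P →* (MvPowerSeries (Fin d) ℂ →ₐ[ℂ] MvPowerSeries (Fin d) ℂ) where
  toFun t := (φ t).val.pullback
  map_one' := by
    rw [map_one]
    exact AlgHom.ext FormalSelfMap.pullback_one
  map_mul' s t := by
    rw [mul_comm, map_mul]
    exact pullback_mul_eq_comp _ _

/-- A subgroup of formal diffeomorphisms all of whose elements belong to a family which is regular
over a finitely generated algebra of functions of the parameter. -/
def IsRegularlyParametrized (H : Subgroup (FormalDiff d)) : Prop :=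
  ∃ (Λ : Type) (R : Subalgebra ℂ (Λ → ℂ)) (g : Λ → FormalDiff d),
    R.FG ∧ IsRegularFamily R (fun a => (g a).val.pullback) ∧ (H : Set (FormalDiff d)) ⊆ Set.range g

theorem isRegularlyParametrized_zpowers (F : FormalDiff d) :
    IsRegularlyParametrized (Subgroup.zpowers F) := by
  obtain ⟨S, hS, hreg⟩ := exists_isRegularFamily_of_int (pullbackHom (zpowersHom (FormalDiff d) F))
  refine ⟨ℤ, _, fun k => F ^ k, quasiPolynomials_fg hS, hreg, ?_⟩
  rintro _ ⟨k, rfl⟩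
  exact ⟨k, rfl⟩

theorem isRegularlyParametrized_range_of_isFormalFlow {v : FormalVectorField d}
    {φ : Multiplicative ℂ →* FormalDiff d} (hφ : IsFormalFlow v φ) :
    IsRegularlyParametrized φ.range := by
  let R₀ : Subalgebra ℂ (ℂ → ℂ) :=
    { carrier := {f | DifferentiableAt ℂ f 0}
      mul_mem' := fun hf hg => hf.mul hg
      add_mem' := fun hf hg => hf.add hg
      algebraMap_mem' := fun c => differentiableAt_const c }
  have isRegularFamily_R₀ : IsRegularFamily R₀ fun t => pullbackHom φ (ofAdd t) := by
    refine .of_X fun i n => (hφ i n).differentiableAt.congr_of_eventuallyEq (.of_forall fun t => ?_)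
    exact congrArg (coeff n) (FormalSelfMap.pullback_X _ i)
  obtain ⟨S, hS, hreg⟩ := exists_isRegularFamily_of_differentiableAt
    (Ψ := pullbackHom φ) isRegularFamily_R₀
  refine ⟨ℂ, _, fun t => φ (ofAdd t), quasiPolynomials_fg (hS.image _), hreg, ?_⟩
  rintro _ ⟨t, rfl⟩
  exact ⟨toAdd t, rfl⟩

theorem isRegularlyParametrized_bot : IsRegularlyParametrized (⊥ : Subgroup (FormalDiff d)) := by
  simpa using isRegularlyParametrized_zpowers (1 : FormalDiff d)

theorem IsRegularlyParametrized.sup {H₁ H₂ : Subgroup (FormalDiff d)}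
    (h₁ : IsRegularlyParametrized H₁) (h₂ : IsRegularlyParametrized H₂)
    (hcomm : ∀ g ∈ H₁, ∀ h ∈ H₂, g * h = h * g) : IsRegularlyParametrized (H₁ ⊔ H₂) := by
  obtain ⟨Λ₁, R₁, g₁, hR₁, hg₁, hH₁⟩ := h₁
  obtain ⟨Λ₂, R₂, g₂, hR₂, hg₂, hH₂⟩ := h₂
  refine ⟨Λ₁ × Λ₂, R₁.map (precompAlgHom ℂ Prod.fst) ⊔ R₂.map (precompAlgHom ℂ Prod.snd),
    fun a => g₁ a.1 * g₂ a.2, (hR₁.map _).sup (hR₂.map _), ?_, ?_⟩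
  · simp only [pullback_mul_eq_comp]
    exact ((hg₂.comp_param Prod.snd).mono le_sup_right).comp
      ((hg₁.comp_param Prod.fst).mono le_sup_left)
  · have le_normalizer : H₁ ≤ Subgroup.normalizer (H₂ : Set (FormalDiff d)) :=
      Subgroup.le_normalizer_iff.2 fun g hg h hh => by
      rwa [hcomm g hg h hh, mul_inv_cancel_right]
    rw [Subgroup.coe_mul_of_left_le_normalizer_right H₁ H₂ le_normalizer]
    rintro _ ⟨x, hx, y, hy, rfl⟩
    obtain ⟨a, rfl⟩ := hH₁ hx
    obtain ⟨b, rfl⟩ := hH₂ hy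
    exact ⟨(a, b), rfl⟩

theorem isRegularlyParametrized_iSup {ι : Type*} [Finite ι] {H : ι → Subgroup (FormalDiff d)}
    (hH : ∀ i, IsRegularlyParametrized (H i))
    (hcomm : ∀ g ∈ ⨆ i, H i, ∀ h ∈ ⨆ i, H i, g * h = h * g) :
    IsRegularlyParametrized (⨆ i, H i) := by
  classical
  have := Fintype.ofFinite ι
  suffices h : ∀ s : Finset ι, IsRegularlyParametrized (s.sup H) by
    simpa [Finset.sup_univ_eq_iSup] using h Finset.univ
  intro s
  induction s using Finset.induction_on with
  | empty => simpa using isRegularlyParametrized_bot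
  | insert i s _ ih =>
    rw [Finset.sup_insert]
    exact (hH i).sup ih fun g hg h hh => hcomm g (le_iSup H i hg) h
      ((Finset.sup_le fun j _ => le_iSup H j) hh)

theorem IsFinitelyGeneratedByMapsAndFlows.isRegularlyParametrized {G : Subgroup (FormalDiff d)}
    (hG : IsFinitelyGeneratedByMapsAndFlows G) (hcomm : ∀ g ∈ G, ∀ h ∈ G, g * h = h * g) :
    IsRegularlyParametrized G := by
  obtain ⟨p, q, F, v, φ, hφ, rfl⟩ := hG
  have closure_eq : Subgroup.closure (Set.range F ∪ ⋃ k, Set.range (φ k)) =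
      ⨆ k : Fin p ⊕ Fin q, Sum.elim (fun i => Subgroup.zpowers (F i)) (fun k => (φ k).range) k := by
    rw [iSup_sum, Subgroup.closure_union, Subgroup.closure_iUnion, ← Set.iUnion_singleton_eq_range,
      Subgroup.closure_iUnion]
    simp only [Sum.elim_inl, Sum.elim_inr, Subgroup.zpowers_eq_closure, ← MonoidHom.coe_range,
      Subgroup.closure_eq]
  rw [closure_eq] at hcomm ⊢
  refine isRegularlyParametrized_iSup ?_ hcomm
  rintro (i | k)
  · exact isRegularlyParametrized_zpowers (F i)
  · exact isRegularlyParametrized_range_of_isFormalFlow (hφ k)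

end ParametrizedSubgroups

theorem theorem1_general {d : ℕ} (G : Subgroup (FormalDiff d))
    (hcomm : ∀ g ∈ G, ∀ h ∈ G, g * h = h * g)
    (hfg : IsFinitelyGeneratedByMapsAndFlows G) (I J : Ideal (MvPowerSeries (Fin d) ℂ)) :
    ∃ m : ℕ, ∀ g ∈ G,
      Module.rank ℂ (MvPowerSeries (Fin d) ℂ ⧸ (I.map g.pullbackEquiv ⊔ J)) < Cardinal.aleph0 →
        Module.rank ℂ (MvPowerSeries (Fin d) ℂ ⧸ (I.map g.pullbackEquiv ⊔ J)) ≤ m := by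
  obtain ⟨Λ, R, γ, hR, hγ, hG⟩ := hfg.isRegularlyParametrized hcomm
  have := isNoetherianRing_of_fg hR
  obtain ⟨m, hm⟩ := hγ.exists_forall_rank_quotient_le I J
  refine ⟨m, fun g hg => ?_⟩
  obtain ⟨a, rfl⟩ := hG hg
  exact hm a

theorem theorem1 {d : ℕ} (G : Subgroup (FormalDiff d))
    (hcomm : ∀ g ∈ G, ∀ h ∈ G, g * h = h * g)
    (hfg : IsFinitelyGeneratedByMapsAndFlows G)
    (X Y : FormalSubvariety d) :
    ∃ m : ℕ, ∀ g ∈ G,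
      intersectionMultiplicity (X.preimage g) Y < ⊤ →
        intersectionMultiplicity (X.preimage g) Y ≤ (m : ℕ∞) := by
  simp only [intersectionMultiplicity, Cardinal.toENat_lt_top, Cardinal.toENat_le_natCast]
  exact theorem1_general G hcomm hfg X.ideal Y.ideal
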